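/- Let $N$ be a non-negative integer, $K$ a field, and $X=(x_1,\dots,x_{N-1})$, $Y=(y_1,\dots,y_{N-2})$ sequences in $K$ with $x_i$ arbitrary and all $y_i\neq 0$. The Okada algebra $O_N(X,Y)$ is the unital associative $K$-algebra generated by $E_1,\dots,E_{N-1}$ with relations $$E_i^2=x_iE_i,\qquad E_iE_j=E_jE_i\ \ (|i-j|\ge 2),\qquad E_{i+1}E_iE_{i+1}=y_iE_{i+1}\ \ (1\le i\le N-2).$$ A Fibonacci set of rank $N$ is a set $S=\{s_1<\dots<s_k\}\subseteq\{1,\dots,N\}$ such that $k\equiv N \pmod 2$ and $s_l\equiv l\pmod 2$ for every $l$. Its free set is $$\mathfrak F(S)=\{\,i\in\{1,\dots,N\} : i-\max\{s\in S: s\le i\}\text{ is odd}\,\},\qquad \max\emptyset:=0.$$ It is contained in $\{1,\dots,N-1\}$ and contains no two consecutive integers, so the free element $E_S=\prod_{i\in\mathfrak F(S)}E_i$ is a well-defined product of commuting generators. Let $\mathfrak J_S$ be the two-sided ideal of $O_N(X,Y)$ generated by $E_S$. For Fibonacci sets $S=\{s_1<\dots<s_k\}$ and $T=\{t_1<\dots<t_\ell\}$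 of rank $N$, write $S\preceq T$ ($S$ is dominated by $T$) if $k\le \ell$ and $s_{k-i}\le t_{\ell-i}$ for all $0\le i<k$. **Proposition.** For all Fibonacci sets $S,T$ of rank $N$, $$\mathfrak J_S\subseteq \mathfrak J_T\quad\Longleftrightarrow\quad S\preceq T.$$ -/

import Mathlib

/-- A Fibonacci set of rank `N`: a subset `{s_1 < ⋯ < s_k}` of `{1, …, N}` such that `k` has
the parity of `N` and each `s_l` has the parity of `l`. In `elt_parity` the index `j` is
`0`-based, so `S.orderEmbOfFin rfl j` is `s_{j+1}`. -/
structure FibonacciSet (N : ℕ) where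
  carrier : Finset ℕ
  subset_Icc : carrier ⊆ Finset.Icc 1 N
  card_parity : carrier.card % 2 = N % 2
  elt_parity : ∀ j : Fin carrier.card,
    carrier.orderEmbOfFin rfl j % 2 = ((j : ℕ) + 1) % 2

namespace FibonacciSet

variable {N : ℕ}

/-- The dominance order `S ⪯ T` for `S = {s_1 < ⋯ < s_k}`, `T = {t_1 < ⋯ < t_l}`:
`k ≤ l` and `s_{k-i} ≤ t_{l-i}` for `0 ≤ i < k`. (The `0`-based index of `s_{k-i}` is
`k - 1 - i`.) -/
def DominatedBy (S T : FibonacciSet N) : Prop :=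
  ∃ hkl : S.carrier.card ≤ T.carrier.card,
    ∀ (i : ℕ) (hi : i < S.carrier.card),
      S.carrier.orderEmbOfFin rfl ⟨S.carrier.card - 1 - i, by omega⟩ ≤
        T.carrier.orderEmbOfFin rfl ⟨T.carrier.card - 1 - i, by omega⟩

/-- The free set `F(S)`: all `i` in `{1, …, N}` for which `i - max {s ∈ S | s ≤ i}` is odd,
where the maximum of the empty set is `0`. -/
def freeSet (S : FibonacciSet N) : Finset ℕ :=
  (Finset.Icc 1 N).filter fun i => Odd (i - (S.carrier.filter (· ≤ i)).sup id)

theorem mem_freeSet_pos {S : FibonacciSet N} {i : ℕ} (hi : i ∈ S.freeSet) : 1 ≤ i :=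
  (Finset.mem_Icc.1 (Finset.mem_filter.1 hi).1).1

theorem mem_freeSet_lt {S : FibonacciSet N} {i : ℕ} (hi : i ∈ S.freeSet) : i < N := by
  obtain ⟨hI, hodd⟩ := Finset.mem_filter.1 hi
  obtain ⟨-, hle⟩ := Finset.mem_Icc.1 hI
  refine lt_of_le_of_ne hle ?_
  rintro rfl
  have hfil : S.carrier.filter (· ≤ i) = S.carrier :=
    Finset.filter_true_of_mem fun s hs => (Finset.mem_Icc.1 (S.subset_Icc hs)).2
  rw [hfil, Nat.odd_iff] at hodd
  have hc := S.card_parity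
  rcases Nat.eq_zero_or_pos S.carrier.card with h0 | hpos
  · rw [Finset.card_eq_zero.1 h0] at hodd
    simp at hodd
    omega
  · have hp := S.elt_parity ⟨S.carrier.card - 1, by omega⟩
    have hne : S.carrier.Nonempty := Finset.card_pos.1 hpos
    rw [Finset.orderEmbOfFin_last rfl hpos, Finset.max'_eq_sup', Finset.sup'_eq_sup] at hp
    have hsup : S.carrier.sup id ≤ i :=
      Finset.sup_le fun s hs => (Finset.mem_Icc.1 (S.subset_Icc hs)).2
    simp only at hp
    omega

theorem succ_notMem_freeSet {S : FibonacciSet N} {i : ℕ} (hi : i ∈ S.freeSet) :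
    i + 1 ∉ S.freeSet := by
  intro hi'
  have h1 := (Finset.mem_filter.1 hi).2
  have h2 := (Finset.mem_filter.1 hi').2
  by_cases hS : i + 1 ∈ S.carrier
  · have : i + 1 ≤ (S.carrier.filter (· ≤ i + 1)).sup id :=
      Finset.le_sup (f := id) (Finset.mem_filter.2 ⟨hS, le_rfl⟩)
    rw [Nat.sub_eq_zero_of_le this] at h2
    simp at h2
  · have hf : S.carrier.filter (· ≤ i + 1) = S.carrier.filter (· ≤ i) := by
      refine Finset.filter_congr fun s hs => ?_
      have : s ≠ i + 1 := fun h => hS (h ▸ hs)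
      omega
    have hsup : (S.carrier.filter (· ≤ i)).sup id ≤ i :=
      Finset.sup_le fun s hs => (Finset.mem_filter.1 hs).2
    rw [hf, Nat.odd_iff] at h2
    rw [Nat.odd_iff] at h1
    omega

end FibonacciSet

/-- The indices `1, …, N - 1` of the generators of the Okada algebra of rank `N`. -/
abbrev OkadaIndex (N : ℕ) : Type := {i : ℕ // 1 ≤ i ∧ i < N}

/-- The defining relations of the Okada algebra, in the free algebra on `E_1, …, E_{N-1}`.
Only the entries `x_1, …, x_{N-1}` and `y_1, …, y_{N-2}` of the sequences `x`, `y` are used. -/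
inductive OkadaRel {K : Type*} [Field K] (N : ℕ) (x y : ℕ → K) :
    FreeAlgebra K (OkadaIndex N) → FreeAlgebra K (OkadaIndex N) → Prop
  | sq (i : OkadaIndex N) :
      OkadaRel N x y (FreeAlgebra.ι K i * FreeAlgebra.ι K i) (x i • FreeAlgebra.ι K i)
  | comm (i j : OkadaIndex N) (hij : (i : ℕ) + 2 ≤ j ∨ (j : ℕ) + 2 ≤ i) :
      OkadaRel N x y (FreeAlgebra.ι K i * FreeAlgebra.ι K j)
        (FreeAlgebra.ι K j * FreeAlgebra.ι K i)
  | contract (i j : OkadaIndex N) (hij : (j : ℕ) = i + 1) :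
      OkadaRel N x y (FreeAlgebra.ι K j * FreeAlgebra.ι K i * FreeAlgebra.ι K j)
        (y i • FreeAlgebra.ι K j)

/-- The Okada algebra `O_N(X, Y)` over the field `K`. -/
abbrev OkadaAlgebra {K : Type*} [Field K] (N : ℕ) (x y : ℕ → K) : Type _ :=
  RingQuot (OkadaRel N x y)

namespace OkadaAlgebra

variable {K : Type*} [Field K] {N : ℕ} (x y : ℕ → K)

/-- The generator `E_i` of the Okada algebra. -/
noncomputable def gen (i : OkadaIndex N) : OkadaAlgebra N x y :=
  RingQuot.mkAlgHom K (OkadaRel N x y) (FreeAlgebra.ι K i)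

theorem gen_commute (i j : OkadaIndex N) (hij : (i : ℕ) + 2 ≤ j ∨ (j : ℕ) + 2 ≤ i) :
    Commute (gen x y i) (gen x y j) := by
  have h := RingQuot.mkAlgHom_rel K (OkadaRel.comm (x := x) (y := y) i j hij)
  simpa [gen, Commute, SemiconjBy] using h

/-- The element of `OkadaIndex N` given by a member of a free set. -/
def freeIndex (S : FibonacciSet N) (i : S.freeSet) : OkadaIndex N :=
  ⟨i, FibonacciSet.mem_freeSet_pos i.2, FibonacciSet.mem_freeSet_lt i.2⟩

theorem gen_freeIndex_commute (S : FibonacciSet N) (i j : S.freeSet) (hij : i ≠ j) :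
    Commute (gen x y (freeIndex S i)) (gen x y (freeIndex S j)) := by
  refine gen_commute x y _ _ ?_
  have h0 : (i : ℕ) ≠ j := fun h => hij (Subtype.ext h)
  have h1 : (j : ℕ) ≠ i + 1 := fun h => FibonacciSet.succ_notMem_freeSet i.2 (h ▸ j.2)
  have h2 : (i : ℕ) ≠ j + 1 := fun h => FibonacciSet.succ_notMem_freeSet j.2 (h ▸ i.2)
  simp only [freeIndex]
  omega

/-- The free element `E_S`, the product of the pairwise commuting generators `E_i` with
`i` in the free set `F(S)`. -/
noncomputable def freeElement (S : FibonacciSet N) : OkadaAlgebra N x y :=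
  S.freeSet.attach.noncommProd (fun i => gen x y (freeIndex S i))
    (fun i _ j _ hij => gen_freeIndex_commute x y S i j hij)

/-- The two-sided ideal `J_S` generated by the free element `E_S`. -/
noncomputable def freeIdeal (S : FibonacciSet N) : TwoSidedIdeal (OkadaAlgebra N x y) :=
  TwoSidedIdeal.span {freeElement x y S}

end OkadaAlgebra

/-!
Domination is equivalent to `|{s ∈ S | m ≤ s}| ≤ |{t ∈ T | m ≤ t}|` for all `m`.

If `S ⪯ T`, then the `j`-th largest element of `F(T)`, if it exists, is at most that of `F(S)`.
Multiplying `E_i` by `E_{i+1}` on both sides turns it into `y_i E_{i+1}`, and `y_i` is invertible,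
so within `J_T` the factors of `E_T` can be moved up to those of `E_S`, the largest one first;
the factors of `E_S` which are left over are then multiplied to the result.

For the converse, write `y_i = c_i c_{i+1}` with all `c_i ≠ 0`. Then `O_N` acts on linear
combinations of labelled arc diagrams: `E_i` joins the strands ending at `i` and `i + 1`, keeping
the smaller label, adds an arc from `i` to `i + 1` labelled `i`, and multiplies by `c_i`; a closed
loop labelled `l` contributes `x_l / c_l`. No `E_i` increases the number of through lines of label
at least `m`. The diagrams in the image of `E_T` have lines only at the points of `T`, and labels
are bounded by positions, so at most `|{t ∈ T | m ≤ t}|` of these lines have label at least `m`.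
But `E_S` maps the diagram without arcs to a nonzero multiple of a diagram with a line of label
`s` at each `s ∈ S`. Hence `E_S ∈ J_T` forces `|{s ∈ S | m ≤ s}| ≤ |{t ∈ T | m ≤ t}|`.
-/

theorem le_orderEmbOfFin_iff_card_sub_le {α : Type*} [LinearOrder α] (A : Finset α)
    (j : Fin A.card) (m : α) :
    m ≤ A.orderEmbOfFin rfl j ↔ A.card - j ≤ (A.filter (m ≤ ·)).card := by
  have hcard : (A.filter (m ≤ ·)).card =
      (Finset.univ.filter fun k ↦ m ≤ A.orderEmbOfFin rfl k).card := by
    conv_lhs => rw [← A.map_orderEmbOfFin_univ rfl, Finset.filter_map, Finset.card_map]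
    rfl
  rw [hcard]
  refine ⟨fun h ↦ ?_, fun h ↦ ?_⟩
  · rw [← Fin.card_Ici]
    refine Finset.card_le_card fun k hk ↦ Finset.mem_filter.2 ⟨Finset.mem_univ k, ?_⟩
    exact h.trans ((A.orderEmbOfFin rfl).monotone (Finset.mem_Ici.1 hk))
  · by_contra! hlt
    have hsub : (Finset.univ.filter fun k ↦ m ≤ A.orderEmbOfFin rfl k) ⊆ Finset.Ioi j :=
      fun k hk ↦ Finset.mem_Ioi.2 <|
        (A.orderEmbOfFin rfl).lt_iff_lt.1 (hlt.trans_le (Finset.mem_filter.1 hk).2)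
    have := Finset.card_le_card hsub
    rw [Fin.card_Ioi] at this
    omega

theorem sublistForall₂_le_of_countP_le {α : Type*} [LinearOrder α] {f g : List α}
    (hf : f.Pairwise (· ≥ ·)) (hg : g.Pairwise (· ≥ ·))
    (h : ∀ m, f.countP (m ≤ ·) ≤ g.countP (m ≤ ·)) : f.SublistForall₂ (· ≤ ·) g := by
  induction f generalizing g with
  | nil => exact .nil
  | cons a f ih =>
    obtain ⟨hfa, hf⟩ := List.pairwise_cons.1 hf
    obtain ⟨c, hc, hac⟩ : ∃ c ∈ g, a ≤ c := by
      simpa using (List.countP_pos_iff.2 ⟨a, by simp, by simp⟩).trans_le (h a)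
    cases g with
    | nil => simp at hc
    | cons b g =>
      obtain ⟨hgb, hg⟩ := List.pairwise_cons.1 hg
      have hab : a ≤ b := (List.mem_cons.1 hc).elim (· ▸ hac) fun hcg ↦ hac.trans (hgb c hcg)
      refine .cons hab (ih hf hg fun m ↦ ?_)
      rcases le_or_gt m a with hma | ham
      · simpa [List.countP_cons, hma, hma.trans hab] using h m
      · rw [List.countP_eq_zero.2 fun c hc ↦ by simpa using (hfa c hc).trans_lt ham]
        exact Nat.zero_le _

theorem exists_ne_zero_mul_succ_eq {G : Type*} [GroupWithZero G] (y : ℕ → G) :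
    ∃ c : ℕ → G, (∀ i, c i ≠ 0) ∧ ∀ i, y i ≠ 0 → c i * c (i + 1) = y i := by
  classical
  let c (n : ℕ) : G := n.rec 1 fun i a ↦ a⁻¹ * if y i = 0 then 1 else y i
  have hc (i : ℕ) : c i ≠ 0 := by
    induction i with
    | zero => exact one_ne_zero
    | succ i ih =>
      refine mul_ne_zero (inv_ne_zero ih) ?_
      split_ifs with h
      exacts [one_ne_zero, h]
  refine ⟨c, hc, fun i hi ↦ ?_⟩
  change c i * ((c i)⁻¹ * if y i = 0 then 1 else y i) = y i
  rw [if_neg hi, mul_inv_cancel_left₀ (hc i)]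

namespace FibonacciSet

variable {N : ℕ} {S T : FibonacciSet N}

theorem dominatedBy_iff_card_filter_le :
    S.DominatedBy T ↔ ∀ m, (S.carrier.filter (m ≤ ·)).card ≤ (T.carrier.filter (m ≤ ·)).card := by
  refine ⟨fun ⟨hST, hle⟩ m ↦ ?_, fun h ↦ ⟨by simpa using h 0, fun i hi ↦ ?_⟩⟩
  · set r := (S.carrier.filter (m ≤ ·)).card
    obtain hr | hr := r.eq_zero_or_pos
    · exact hr ▸ Nat.zero_le _
    have hrS : r ≤ S.carrier.card := Finset.card_filter_le _ _
    have hmS := (le_orderEmbOfFin_iff_card_sub_le S.carrier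
      ⟨S.carrier.card - 1 - (r - 1), by omega⟩ m).2 (by dsimp only; omega)
    have hmT := (le_orderEmbOfFin_iff_card_sub_le _ _ m).1 (hmS.trans (hle (r - 1) (by omega)))
    dsimp only at hmT
    omega
  · have hS := (le_orderEmbOfFin_iff_card_sub_le S.carrier ⟨S.carrier.card - 1 - i, by omega⟩ _).1
      le_rfl
    rw [le_orderEmbOfFin_iff_card_sub_le]
    refine le_trans ?_ (hS.trans (h _))
    dsimp only
    omega

theorem sup_filter_le_mod_two_of_succ_mem {i : ℕ} (hi : i + 1 ∈ S.carrier) :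
    (S.carrier.filter (· ≤ i)).sup id % 2 = i % 2 := by
  set e := S.carrier.orderEmbOfFin rfl with he
  have hrange (a : ℕ) (ha : a ∈ S.carrier) : ∃ j, e j = a :=
    Set.mem_range.1 (by rwa [he, Finset.range_orderEmbOfFin])
  obtain ⟨⟨j, hj⟩, hij⟩ := hrange _ hi
  have hparity := S.elt_parity ⟨j, hj⟩
  rw [← he, hij] at hparity
  cases j with
  | zero =>
    have hempty : S.carrier.filter (· ≤ i) = ∅ := by
      refine Finset.filter_eq_empty_iff.2 fun a ha hai ↦ ?_
      obtain ⟨k, rfl⟩ := hrange a ha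
      have : e ⟨0, hj⟩ ≤ e k := e.monotone (Fin.mk_le_of_le_val k.1.zero_le)
      omega
    rw [hempty, Finset.sup_empty, Nat.bot_eq_zero]
    dsimp only at hparity
    omega
  | succ j =>
    have hsup : (S.carrier.filter (· ≤ i)).sup id = e ⟨j, by omega⟩ := by
      refine le_antisymm (Finset.sup_le fun a ha ↦ ?_) (Finset.le_sup (f := id) ?_)
      · obtain ⟨haS, hai⟩ := Finset.mem_filter.1 ha
        obtain ⟨k, rfl⟩ := hrange a haS
        have hk : k < ⟨j + 1, hj⟩ := e.lt_iff_lt.1 (by omega)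
        exact e.monotone (Nat.lt_succ_iff.1 hk)
      · have : e ⟨j, by omega⟩ < e ⟨j + 1, hj⟩ := e.strictMono (Fin.mk_lt_mk.2 j.lt_succ_self)
        exact Finset.mem_filter.2 ⟨S.carrier.orderEmbOfFin_mem rfl _, by omega⟩
    rw [hsup, he, S.elt_parity]
    dsimp only at hparity ⊢
    omega

theorem succ_mem_carrier_iff {i : ℕ} (hi : i < N) :
    i + 1 ∈ S.carrier ↔ i ∉ S.freeSet ∧ i + 1 ∉ S.freeSet := by
  have hle (j : ℕ) : (S.carrier.filter (· ≤ j)).sup id ≤ j :=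
    Finset.sup_le fun s hs ↦ (Finset.mem_filter.1 hs).2
  simp only [freeSet, Finset.mem_filter, Finset.mem_Icc, Nat.odd_iff]
  refine ⟨fun hS ↦ ?_, fun hF ↦ ?_⟩
  · have := sup_filter_le_mod_two_of_succ_mem hS
    have : i + 1 ≤ (S.carrier.filter (· ≤ i + 1)).sup id :=
      Finset.le_sup (f := id) (Finset.mem_filter.2 ⟨hS, le_rfl⟩)
    have := hle i
    omega
  · by_contra hS
    have hfilter : S.carrier.filter (· ≤ i + 1) = S.carrier.filter (· ≤ i) :=
      Finset.filter_congr fun s hs ↦ by have := ne_of_mem_of_not_mem hs hS; omega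
    have := hle i
    rw [hfilter] at hF
    omega

theorem card_filter_add_card_freeSet_filter (S : FibonacciSet N) (m : ℕ) :
    (S.carrier.filter (m + 1 ≤ ·)).card + (S.freeSet.filter (m + 1 ≤ ·)).card +
      (S.freeSet.filter (m ≤ ·)).card = N - m := by
  have hlt (i : ℕ) : i ∈ S.freeSet → i < N := mem_freeSet_lt
  have hS (i : ℕ) (hi : i + 1 ∈ S.carrier) : i < N := (Finset.mem_Icc.1 (S.subset_Icc hi)).2
  have hsucc (i : ℕ) : i < N → (i + 1 ∈ S.carrier ↔ i ∉ S.freeSet ∧ i + 1 ∉ S.freeSet) :=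
    succ_mem_carrier_iff
  have hFF (i : ℕ) : i ∈ S.freeSet → i + 1 ∉ S.freeSet := succ_notMem_freeSet
  have hcover : S.carrier.filter (m + 1 ≤ ·) ∪ S.freeSet.filter (m + 1 ≤ ·) ∪
      (S.freeSet.filter (m ≤ ·)).map (addRightEmbedding 1) = Finset.Ioc m N := by
    ext (_ | i) <;>
      simp only [Finset.mem_union, Finset.mem_filter, Finset.mem_map, Finset.mem_Ioc,
        addRightEmbedding_apply] <;> grind
  have hdisj : Disjoint (S.carrier.filter (m + 1 ≤ ·)) (S.freeSet.filter (m + 1 ≤ ·)) := by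
    refine Finset.disjoint_left.2 fun a ↦ ?_
    rcases a with _ | i <;> grind
  have hdisj' : Disjoint (S.carrier.filter (m + 1 ≤ ·) ∪ S.freeSet.filter (m + 1 ≤ ·))
      ((S.freeSet.filter (m ≤ ·)).map (addRightEmbedding 1)) := by
    refine Finset.disjoint_right.2 fun a ha ↦ ?_
    obtain ⟨i, hi, rfl⟩ := Finset.mem_map.1 ha
    grind
  rw [← Nat.card_Ioc, ← hcover, Finset.card_union_of_disjoint hdisj',
    Finset.card_union_of_disjoint hdisj, Finset.card_map]

theorem card_freeSet_filter_le_of_dominatedBy (h : S.DominatedBy T) (m : ℕ) :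
    (T.freeSet.filter (m ≤ ·)).card ≤ (S.freeSet.filter (m ≤ ·)).card := by
  have hS := S.card_filter_add_card_freeSet_filter m
  have hT := T.card_filter_add_card_freeSet_filter m
  have hcarrier := dominatedBy_iff_card_filter_le.1 h (m + 1)
  have hmono : (S.freeSet.filter (m + 1 ≤ ·)).card ≤ (S.freeSet.filter (m ≤ ·)).card :=
    Finset.card_le_card (Finset.monotone_filter_right _ fun a _ (ha : m + 1 ≤ a) ↦ by omega)
  have hstep : (T.freeSet.filter (m ≤ ·)).card ≤ (T.freeSet.filter (m + 1 ≤ ·)).card + 1 := by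
    refine (Finset.card_le_card fun a ha ↦ ?_).trans (Finset.card_insert_le m _)
    simp only [Finset.mem_filter, Finset.mem_insert] at ha ⊢
    grind
  omega

/-- The members of the free set in decreasing order, which turns `E_S` into a list product. -/
def freeList (S : FibonacciSet N) : List ℕ := S.freeSet.sort (· ≥ ·)

theorem mem_freeList {S : FibonacciSet N} {i : ℕ} : i ∈ S.freeList ↔ i ∈ S.freeSet :=
  Finset.mem_sort _

theorem pairwise_freeList (S : FibonacciSet N) : S.freeList.Pairwise fun a b ↦ b + 2 ≤ a := by
  have hsorted : S.freeList.Pairwise (· > ·) := Finset.sortedGT_sort _ |>.pairwise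
  refine hsorted.imp_of_mem fun {a b} ha hb hab ↦ ?_
  have : a ≠ b + 1 := fun h ↦ succ_notMem_freeSet (mem_freeList.1 hb) (h ▸ mem_freeList.1 ha)
  omega

theorem countP_freeList (S : FibonacciSet N) (m : ℕ) :
    S.freeList.countP (m ≤ ·) = (S.freeSet.filter (m ≤ ·)).card := by
  rw [Finset.card_def, Finset.filter_val, ← Multiset.countP_eq_card_filter,
    ← Finset.sort_eq S.freeSet (· ≥ ·), Multiset.coe_countP]
  rfl

end FibonacciSet

namespace OkadaAlgebra

variable {K : Type*} [Field K] {N : ℕ} (x y : ℕ → K)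

/-- The generator `E_i`, extended by `1` to all natural numbers `i`. -/
noncomputable def genAt (i : ℕ) : OkadaAlgebra N x y :=
  if h : 1 ≤ i ∧ i < N then gen x y ⟨i, h⟩ else 1

theorem genAt_coe (i : OkadaIndex N) : genAt x y (i : ℕ) = gen x y i :=
  dif_pos i.2

theorem genAt_commute {i j : ℕ} (hij : i + 2 ≤ j ∨ j + 2 ≤ i) :
    Commute (genAt x y i : OkadaAlgebra N x y) (genAt x y j) := by
  unfold genAt
  split_ifs
  exacts [gen_commute x y _ _ hij, Commute.one_right _, Commute.one_left _, Commute.one_left _]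

theorem genAt_succ_mul_mul_succ {i : ℕ} (hi : 1 ≤ i) (hi' : i + 2 ≤ N) :
    (genAt x y (i + 1) * genAt x y i * genAt x y (i + 1) : OkadaAlgebra N x y) =
      y i • genAt x y (i + 1) := by
  let i₀ : OkadaIndex N := ⟨i, hi, by omega⟩
  let i₁ : OkadaIndex N := ⟨i + 1, by omega, by omega⟩
  have h := RingQuot.mkAlgHom_rel K (OkadaRel.contract (x := x) (y := y) i₀ i₁ rfl)
  rw [genAt_coe x y i₀, genAt_coe x y i₁]
  simpa only [map_mul, map_smul, gen] using h

theorem freeElement_eq_prod (S : FibonacciSet N) :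
    freeElement x y S = (S.freeList.map (genAt x y)).prod := by
  have hval : S.freeSet.attach.1.map (fun i ↦ gen x y (freeIndex S i)) =
      ((S.freeList.map (genAt x y) : List (OkadaAlgebra N x y)) : Multiset _) := by
    rw [← Multiset.map_coe, FibonacciSet.freeList, Finset.sort_eq,
      ← Multiset.attach_map_val' S.freeSet.1 (genAt x y)]
    exact Multiset.map_congr rfl fun i _ ↦ (genAt_coe x y (freeIndex S i)).symm
  unfold freeElement Finset.noncommProd
  simp only [hval]
  exact Multiset.noncommProd_coe _ _

/-- The homomorphism out of the Okada algebra given by elements satisfying its relations. -/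
noncomputable def lift {A : Type*} [Ring A] [Algebra K A] (e : OkadaIndex N → A)
    (hsq : ∀ i, e i * e i = x i • e i)
    (hcomm : ∀ i j : OkadaIndex N, (i : ℕ) + 2 ≤ j → Commute (e i) (e j))
    (hcontract : ∀ i j : OkadaIndex N, (j : ℕ) = i + 1 → e j * e i * e j = y i • e j) :
    OkadaAlgebra N x y →ₐ[K] A :=
  RingQuot.liftAlgHom K ⟨FreeAlgebra.lift K e, fun a b hab ↦ by
    cases hab with
    | sq i => simpa using hsq i
    | comm i j hij =>
      rcases hij with hij | hij
      · simpa using (hcomm i j hij).eq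
      · simpa using (hcomm j i hij).eq.symm
    | contract i j hij => simpa using hcontract i j hij⟩

theorem lift_gen {A : Type*} [Ring A] [Algebra K A] (e : OkadaIndex N → A)
    (hsq : ∀ i, e i * e i = x i • e i)
    (hcomm : ∀ i j : OkadaIndex N, (i : ℕ) + 2 ≤ j → Commute (e i) (e j))
    (hcontract : ∀ i j : OkadaIndex N, (j : ℕ) = i + 1 → e j * e i * e j = y i • e j)
    (i : OkadaIndex N) : lift x y e hsq hcomm hcontract (gen x y i) = e i := by
  simp [lift, gen]

theorem adjoin_range_gen : Algebra.adjoin K (Set.range (gen x y (N := N))) = ⊤ := by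
  have := congrArg (Subalgebra.map (RingQuot.mkAlgHom K (OkadaRel N x y)))
    (FreeAlgebra.adjoin_range_ι (R := K) (X := OkadaIndex N))
  rwa [AlgHom.map_adjoin, ← Set.range_comp, Algebra.map_top,
    (AlgHom.range_eq_top _).2 (RingQuot.mkAlgHom_surjective K _)] at this

end OkadaAlgebra

namespace OkadaAlgebra

variable {K : Type*} [Field K] {N : ℕ} {x y : ℕ → K} {I : TwoSidedIdeal (OkadaAlgebra N x y)}
  {B R : OkadaAlgebra N x y}

theorem mul_genAt_succ_mul_mem {i : ℕ} (hi : 1 ≤ i) (hiN : i + 2 ≤ N) (hy : y i ≠ 0)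
    (hB : Commute B (genAt x y (i + 1))) (hR : Commute (genAt x y (i + 1)) R)
    (h : B * genAt x y i * R ∈ I) : B * genAt x y (i + 1) * R ∈ I := by
  have hconj : genAt x y (i + 1) * (B * genAt x y i * R) * genAt x y (i + 1) =
      y i • (B * genAt x y (i + 1) * R) := by
    calc _ = (genAt x y (i + 1) * B) * genAt x y i * (R * genAt x y (i + 1)) := by
          simp only [mul_assoc]
      _ = B * (genAt x y (i + 1) * genAt x y i * genAt x y (i + 1)) * R := by
          rw [← hB.eq, ← hR.eq]
          simp only [mul_assoc]
      _ = y i • (B * genAt x y (i + 1) * R) := by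
          rw [genAt_succ_mul_mul_succ x y hi hiN, mul_smul_comm, smul_mul_assoc]
  have hmem : y i • (B * genAt x y (i + 1) * R) ∈ I :=
    hconj ▸ I.mul_mem_right _ _ (I.mul_mem_left _ _ h)
  have := I.mul_mem_left (algebraMap K _ (y i)⁻¹) _ hmem
  rwa [← Algebra.smul_def, inv_smul_smul₀ hy] at this

theorem mul_genAt_mul_mem_of_le (hy : ∀ i, 1 ≤ i → i + 2 ≤ N → y i ≠ 0) {a b : ℕ} (ha : 1 ≤ a)
    (hab : a ≤ b) (hb : b < N) (hB : ∀ i ≤ b, Commute B (genAt x y i))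
    (hR : ∀ i > a, Commute (genAt x y i) R) (h : B * genAt x y a * R ∈ I) :
    B * genAt x y b * R ∈ I := by
  induction b, hab using Nat.le_induction with
  | base => exact h
  | succ i hai ih =>
    exact mul_genAt_succ_mul_mem (by omega) (by omega) (hy i (by omega) (by omega))
      (hB _ le_rfl) (hR _ (by omega)) (ih (by omega) fun j hj ↦ hB j (by omega))

theorem mul_prod_genAt_mem_of_sublistForall₂ (hy : ∀ i, 1 ≤ i → i + 2 ≤ N → y i ≠ 0)
    {f g : List ℕ} (hfg : f.SublistForall₂ (· ≤ ·) g) (hf : f.Pairwise fun a b ↦ b + 2 ≤ a)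
    (hg : g.Pairwise fun a b ↦ b + 2 ≤ a) (hf₁ : ∀ a ∈ f, 1 ≤ a) (hgN : ∀ b ∈ g, b < N)
    (hB : ∀ b ∈ g, ∀ i ≤ b, Commute B (genAt x y i))
    (h : B * (f.map (genAt x y)).prod ∈ I) : B * (g.map (genAt x y)).prod ∈ I := by
  induction hfg generalizing B with
  | nil => exact I.mul_mem_right _ _ (by simpa using h)
  | @cons a b f g hab _ ih =>
    simp only [List.pairwise_cons, List.forall_mem_cons] at hf hg hf₁ hgN hB
    rw [List.map_cons, List.prod_cons, ← mul_assoc] at h ⊢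
    refine ih hf.2 hg.2 hf₁.2 hgN.2 (fun c hc i hic ↦ ?_)
      (mul_genAt_mul_mem_of_le hy hf₁.1 hab hgN.1 hB.1 (fun i hi ↦ ?_) h)
    · have := hg.1 c hc
      exact (hB.2 c hc i hic).mul_left (genAt_commute x y (by omega))
    · refine Commute.list_prod_right _ _ (List.forall_mem_map.2 fun c hc ↦ ?_)
      have := hf.1 c hc
      exact genAt_commute x y (by omega)
  | @cons_right b f g _ ih =>
    simp only [List.pairwise_cons, List.forall_mem_cons] at hg hgN hB
    rw [List.map_cons, List.prod_cons, ← mul_assoc, (hB.1 b le_rfl).eq, mul_assoc]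
    exact I.mul_mem_left _ _ (ih hf hg.2 hf₁ hgN.2 hB.2 h)

theorem freeIdeal_le_of_dominatedBy (hy : ∀ i, 1 ≤ i → i + 2 ≤ N → y i ≠ 0)
    {S T : FibonacciSet N} (h : S.DominatedBy T) : freeIdeal x y S ≤ freeIdeal x y T := by
  refine TwoSidedIdeal.span_le.2 (Set.singleton_subset_iff.2 ?_)
  have hT : freeElement x y T ∈ freeIdeal x y T := TwoSidedIdeal.subset_span rfl
  have hTS : T.freeList.SublistForall₂ (· ≤ ·) S.freeList :=
    sublistForall₂_le_of_countP_le (T.pairwise_freeList.imp fun _ ↦ by omega)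
      (S.pairwise_freeList.imp fun _ ↦ by omega) fun m ↦ by
        simpa only [FibonacciSet.countP_freeList]
          using FibonacciSet.card_freeSet_filter_le_of_dominatedBy h m
  rw [freeElement_eq_prod, ← one_mul (List.prod _)] at hT ⊢
  exact mul_prod_genAt_mem_of_sublistForall₂ hy hTS T.pairwise_freeList S.pairwise_freeList
    (fun _ ha ↦ FibonacciSet.mem_freeSet_pos (FibonacciSet.mem_freeList.1 ha))
    (fun _ hb ↦ FibonacciSet.mem_freeSet_lt (FibonacciSet.mem_freeList.1 hb))
    (fun _ _ _ _ ↦ Commute.one_left _) hT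

end OkadaAlgebra

/-- A half diagram on the points `0, 1, 2, …`: some points are joined in pairs by arcs, the others
carry through lines, and every arc and line has a label which is at most the positions of its
points. These diagrams form a basis of the module on which the Okada algebra is represented. -/
@[ext]
structure ArcDiagram where
  partner : ℕ → Option ℕ
  label : ℕ → ℕ
  partner_symm : ∀ {a b}, partner a = some b → partner b = some a
  partner_ne_some_self : ∀ a, partner a ≠ some a
  label_eq_of_partner : ∀ {a b}, partner a = some b → label a = label b
  label_le : ∀ a, label a ≤ a

namespace ArcDiagram

/-- The diagram without arcs, each line being labelled by its own position. -/
def unlinked : ArcDiagram where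
  partner _ := none
  label a := a
  partner_symm := nofun
  partner_ne_some_self := nofun
  label_eq_of_partner := nofun
  label_le _ := le_rfl

/-- The effect of `E_i` on a diagram: the strands ending at `i` and `i + 1` are joined, the result
carrying the smaller of their labels, and a new arc from `i` to `i + 1` with label `i` is added.
A closed loop that arises in this way is discarded, see `loopWeight`. -/
def capCup (i : ℕ) (p : ArcDiagram) : ArcDiagram where
  partner a :=
    if a = i then some (i + 1)
    else if a = i + 1 then some i
    else if p.partner a = some i then p.partner (i + 1)
    else if p.partner a = some (i + 1) then p.partner i
    else p.partner a
  label a :=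
    if a = i ∨ a = i + 1 then i
    else if p.partner a = some i ∨ p.partner a = some (i + 1) then min (p.label i) (p.label (i + 1))
    else p.label a
  partner_symm := by grind [→ partner_symm, partner_ne_some_self]
  partner_ne_some_self := by grind [→ partner_symm, partner_ne_some_self]
  label_eq_of_partner := by
    grind [→ partner_symm, partner_ne_some_self, → label_eq_of_partner]
  label_le a := by
    have := p.label_le a
    grind [→ label_eq_of_partner]

/-- The scalar by which the joining of the strands at `i` and `i + 1` multiplies the diagram: `z l`
if these points are the ends of one arc with label `l`, which then becomes a closed loop. -/
def loopWeight {M : Type*} [One M] (z : ℕ → M) (i : ℕ) (p : ArcDiagram) : M :=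
  if p.partner i = some (i + 1) then z (p.label i) else 1

/-- The number of through lines of label at least `m` at the points `1, …, N`. -/
def lineCount (N m : ℕ) (p : ArcDiagram) : ℕ :=
  ((Finset.Icc 1 N).filter fun a ↦ p.partner a = none ∧ m ≤ p.label a).card

variable (p : ArcDiagram)

theorem partner_capCup (i a : ℕ) : (p.capCup i).partner a =
    if a = i then some (i + 1)
    else if a = i + 1 then some i
    else if p.partner a = some i then p.partner (i + 1)
    else if p.partner a = some (i + 1) then p.partner i
    else p.partner a := rfl

theorem label_capCup (i a : ℕ) : (p.capCup i).label a =
    if a = i ∨ a = i + 1 then i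
    else if p.partner a = some i ∨ p.partner a = some (i + 1) then min (p.label i) (p.label (i + 1))
    else p.label a := rfl

theorem partner_capCup_self (i : ℕ) : (p.capCup i).partner i = some (i + 1) := by
  simp [partner_capCup]

theorem label_capCup_self (i : ℕ) : (p.capCup i).label i = i := by
  simp [label_capCup]

theorem capCup_capCup_self (i : ℕ) : (p.capCup i).capCup i = p.capCup i := by
  ext a : 2 <;> grind [partner_capCup, label_capCup, → partner_symm]

theorem capCup_comm {i j : ℕ} (hij : i + 2 ≤ j) :
    (p.capCup j).capCup i = (p.capCup i).capCup j := by
  ext a : 2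
  · grind (splits := 20) [partner_capCup, → partner_symm, partner_ne_some_self]
  · grind (splits := 20) [partner_capCup, label_capCup, → partner_symm, partner_ne_some_self,
      → label_eq_of_partner]

theorem capCup_succ_capCup_capCup_succ (i : ℕ) :
    ((p.capCup (i + 1)).capCup i).capCup (i + 1) = p.capCup (i + 1) := by
  have harc := p.partner_capCup_self (i + 1)
  have hlabel := p.label_capCup_self (i + 1)
  generalize p.capCup (i + 1) = q at harc hlabel
  ext a : 2
  · grind [partner_capCup, → partner_symm, partner_ne_some_self]
  · grind [partner_capCup, label_capCup, → partner_symm, partner_ne_some_self,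
      → label_eq_of_partner, label_le]

section LoopWeight

variable {M : Type*}

theorem loopWeight_capCup_self [One M] (z : ℕ → M) (i : ℕ) : (p.capCup i).loopWeight z i = z i := by
  rw [loopWeight, if_pos (p.partner_capCup_self i), label_capCup_self]

theorem loopWeight_capCup_succ [One M] (z : ℕ → M) (i : ℕ) :
    (p.capCup (i + 1)).loopWeight z i = 1 := by
  grind [loopWeight, partner_capCup, → partner_symm]

theorem loopWeight_succ_capCup [One M] (z : ℕ → M) (i : ℕ) :
    (p.capCup i).loopWeight z (i + 1) = 1 := by
  grind [loopWeight, partner_capCup]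

theorem loopWeight_mul_loopWeight_capCup [CommMonoid M] (z : ℕ → M) {i j : ℕ} (hij : i + 2 ≤ j) :
    p.loopWeight z j * (p.capCup j).loopWeight z i =
      p.loopWeight z i * (p.capCup i).loopWeight z j := by
  grind [loopWeight, partner_capCup, label_capCup, → partner_symm, → label_eq_of_partner, mul_comm]

end LoopWeight

theorem lineCount_capCup_le {N i : ℕ} (hi : 1 ≤ i) (hiN : i < N) (m : ℕ) :
    (p.capCup i).lineCount N m ≤ p.lineCount N m := by
  let source a :=
    if p.partner a = some i then i + 1 else if p.partner a = some (i + 1) then i else a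
  refine Finset.card_le_card_of_injOn source (fun a ha ↦ ?_) (fun a ha b hb hab ↦ ?_)
  · simp only [Finset.coe_filter, Finset.mem_Icc, Set.mem_ofPred_eq] at ha ⊢
    grind [partner_capCup, label_capCup, → label_eq_of_partner]
  · simp only [Finset.coe_filter, Finset.mem_Icc, Set.mem_ofPred_eq] at ha hb
    grind [partner_capCup, → partner_symm]

end ArcDiagram

namespace ArcDiagram

variable {R : Type*} [CommRing R] (c z : ℕ → R)

/-- The linear extension of the action of `E_i` on diagrams, where joining two points contributes
the factor `c i` and closing a loop with label `l` the factor `z l`. -/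
noncomputable def capCupEnd (i : ℕ) : Module.End R (ArcDiagram →₀ R) :=
  Finsupp.linearCombination R fun p ↦ Finsupp.single (p.capCup i) (c i * p.loopWeight z i)

theorem capCupEnd_single (i : ℕ) (p : ArcDiagram) (a : R) :
    capCupEnd c z i (Finsupp.single p a) =
      Finsupp.single (p.capCup i) (a * (c i * p.loopWeight z i)) := by
  rw [capCupEnd, Finsupp.linearCombination_single, Finsupp.smul_single, smul_eq_mul]

theorem capCupEnd_mem_supported {i : ℕ} {A B : Set ArcDiagram} (h : ∀ p ∈ A, p.capCup i ∈ B)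
    {v : ArcDiagram →₀ R} (hv : v ∈ Finsupp.supported R R A) :
    capCupEnd c z i v ∈ Finsupp.supported R R B := by
  rw [capCupEnd, Finsupp.linearCombination_apply]
  exact Submodule.sum_mem _ fun p hp ↦
    Submodule.smul_mem _ _ (Finsupp.single_mem_supported R _ (h p (hv hp)))

theorem capCupEnd_mul_self (i : ℕ) :
    capCupEnd c z i * capCupEnd c z i = (c i * z i) • capCupEnd c z i := by
  ext1 p
  ext1
  simp only [LinearMap.comp_apply, Finsupp.lsingle_apply, Module.End.mul_apply,
    LinearMap.smul_apply, capCupEnd_single, capCup_capCup_self, loopWeight_capCup_self,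
    Finsupp.smul_single, smul_eq_mul]
  congr 1
  ring

theorem capCupEnd_commute {i j : ℕ} (hij : i + 2 ≤ j) :
    Commute (capCupEnd c z i) (capCupEnd c z j) := by
  ext1 p
  ext1
  simp only [LinearMap.comp_apply, Finsupp.lsingle_apply, Module.End.mul_apply, capCupEnd_single,
    p.capCup_comm hij]
  congr 1
  linear_combination c i * c j * p.loopWeight_mul_loopWeight_capCup z hij

theorem capCupEnd_succ_mul_mul_succ (i : ℕ) :
    capCupEnd c z (i + 1) * capCupEnd c z i * capCupEnd c z (i + 1) =
      (c i * c (i + 1)) • capCupEnd c z (i + 1) := by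
  ext1 p
  ext1
  simp only [LinearMap.comp_apply, Finsupp.lsingle_apply, Module.End.mul_apply,
    LinearMap.smul_apply, capCupEnd_single, capCup_succ_capCup_capCup_succ, loopWeight_capCup_succ,
    loopWeight_succ_capCup, Finsupp.smul_single, smul_eq_mul]
  congr 1
  ring

theorem prod_capCupEnd_mem_supported {l : List ℕ} (hl : l.Pairwise fun a b ↦ b + 2 ≤ a)
    (v : ArcDiagram →₀ R) :
    (l.map (capCupEnd c z)).prod v ∈
      Finsupp.supported R R {p | ∀ i ∈ l, p.partner i = some (i + 1)} := by
  induction l with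
  | nil => simp
  | cons i l ih =>
    obtain ⟨hi, hl⟩ := List.pairwise_cons.1 hl
    rw [List.map_cons, List.prod_cons, Module.End.mul_apply]
    refine capCupEnd_mem_supported c z (B := {p | ∀ j ∈ i :: l, p.partner j = some (j + 1)})
      (fun p hp ↦ ?_) (ih hl)
    refine List.forall_mem_cons.2 ⟨p.partner_capCup_self i, fun j hj ↦ ?_⟩
    have := hi j hj
    have := hp j hj
    grind [partner_capCup, partner_symm]

theorem exists_prod_capCupEnd_single_unlinked [IsDomain R] {c : ℕ → R} (hc : ∀ i, c i ≠ 0)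
    {l : List ℕ} (hl : l.Pairwise fun a b ↦ b + 2 ≤ a) :
    ∃ p a, a ≠ 0 ∧ (l.map (capCupEnd c z)).prod (Finsupp.single unlinked 1) = Finsupp.single p a ∧
      ∀ k, (∀ i ∈ l, k ≠ i ∧ k ≠ i + 1) → p.partner k = none ∧ p.label k = k := by
  induction l with
  | nil => exact ⟨unlinked, 1, one_ne_zero, rfl, fun k _ ↦ ⟨rfl, rfl⟩⟩
  | cons i l ih =>
    obtain ⟨hi, hl⟩ := List.pairwise_cons.1 hl
    obtain ⟨p, a, ha, hpa, hp⟩ := ih hl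
    obtain ⟨hpi, -⟩ := hp i fun j hj ↦ by have := hi j hj; omega
    have hweight : p.loopWeight z i = 1 := by simp [loopWeight, hpi]
    refine ⟨p.capCup i, a * c i, mul_ne_zero ha (hc i), ?_, fun k hk ↦ ?_⟩
    · rw [List.map_cons, List.prod_cons, Module.End.mul_apply, hpa, capCupEnd_single, hweight,
        mul_one]
    · obtain ⟨hki, hkl⟩ := List.forall_mem_cons.1 hk
      have := hp k hkl
      simp [partner_capCup, label_capCup, this, hki]

end ArcDiagram

namespace FibonacciSet

open ArcDiagram

variable {N : ℕ} (S : FibonacciSet N) {p : ArcDiagram}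

theorem lineCount_le_card_filter (hp : ∀ i ∈ S.freeList, p.partner i = some (i + 1)) (m : ℕ) :
    p.lineCount N m ≤ (S.carrier.filter (m ≤ ·)).card := by
  refine Finset.card_le_card fun a ha ↦ ?_
  obtain ⟨haN, hline, hm⟩ := Finset.mem_filter.1 ha
  obtain ⟨h₁, haN⟩ := Finset.mem_Icc.1 haN
  obtain ⟨i, rfl⟩ := Nat.exists_eq_add_of_le' h₁
  have hnotMem : i ∉ S.freeSet ∧ i + 1 ∉ S.freeSet := by
    constructor <;> intro hi <;> have := hp _ (mem_freeList.2 hi)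
    · simp [p.partner_symm this] at hline
    · simp [this] at hline
  exact Finset.mem_filter.2 ⟨(succ_mem_carrier_iff haN).2 hnotMem, hm.trans (p.label_le _)⟩

theorem card_filter_le_lineCount
    (hp : ∀ k, (∀ i ∈ S.freeList, k ≠ i ∧ k ≠ i + 1) → p.partner k = none ∧ p.label k = k)
    (m : ℕ) : (S.carrier.filter (m ≤ ·)).card ≤ p.lineCount N m := by
  refine Finset.card_le_card fun a ha ↦ ?_
  obtain ⟨haS, hm⟩ := Finset.mem_filter.1 ha
  have haN := S.subset_Icc haS
  obtain ⟨i, rfl⟩ := Nat.exists_eq_add_of_le' (Finset.mem_Icc.1 haN).1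
  obtain ⟨hi, hi'⟩ := (succ_mem_carrier_iff (Finset.mem_Icc.1 haN).2).1 haS
  obtain ⟨hline, hlabel⟩ := hp (i + 1) fun j hj ↦
    have hj := mem_freeList.1 hj
    ⟨fun h ↦ hi' (h ▸ hj), fun h ↦ hi (Nat.succ_injective h ▸ hj)⟩
  exact Finset.mem_filter.2 ⟨haN, hline, hlabel.symm ▸ hm⟩

end FibonacciSet

namespace OkadaAlgebra

open ArcDiagram

variable {K : Type*} [Field K] {N : ℕ} {x y c : ℕ → K}

/-- The representation of the Okada algebra on linear combinations of diagrams, for scalars `c i`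
which factor the parameters `y i`. -/
noncomputable def diagramRep (hc : ∀ i, c i ≠ 0)
    (hcy : ∀ i, 1 ≤ i → i + 2 ≤ N → c i * c (i + 1) = y i) :
    OkadaAlgebra N x y →ₐ[K] Module.End K (ArcDiagram →₀ K) :=
  lift x y (fun i ↦ capCupEnd c (fun l ↦ x l / c l) i)
    (fun i ↦ by rw [capCupEnd_mul_self, mul_div_cancel₀ _ (hc i)])
    (fun _ _ ↦ capCupEnd_commute _ _)
    (fun i j hij ↦ by
      rw [hij, capCupEnd_succ_mul_mul_succ, hcy i i.2.1 (by have := j.2.2; omega)])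

variable (hc : ∀ i, c i ≠ 0) (hcy : ∀ i, 1 ≤ i → i + 2 ≤ N → c i * c (i + 1) = y i)

theorem diagramRep_gen (i : OkadaIndex N) :
    diagramRep hc hcy (gen x y i) = capCupEnd c (fun l ↦ x l / c l) i :=
  lift_gen _ _ _ _ _ _ i

theorem diagramRep_freeElement (S : FibonacciSet N) :
    diagramRep hc hcy (freeElement x y S) =
      (S.freeList.map (capCupEnd c fun l ↦ x l / c l)).prod := by
  rw [freeElement_eq_prod, map_list_prod, List.map_map]
  refine congrArg List.prod (List.map_congr_left fun i hi ↦ ?_)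
  have hiS := FibonacciSet.mem_freeList.1 hi
  let j : OkadaIndex N := ⟨i, FibonacciSet.mem_freeSet_pos hiS, FibonacciSet.mem_freeSet_lt hiS⟩
  exact (congrArg _ (genAt_coe x y j)).trans (diagramRep_gen hc hcy j)

theorem diagramRep_mem_supported_lineCount_le (u : OkadaAlgebra N x y) (m r : ℕ)
    {v : ArcDiagram →₀ K} (hv : v ∈ Finsupp.supported K K {p | p.lineCount N m ≤ r}) :
    diagramRep hc hcy u v ∈ Finsupp.supported K K {p | p.lineCount N m ≤ r} := by
  have hu : u ∈ Algebra.adjoin K (Set.range (gen x y)) := by simp [adjoin_range_gen]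
  induction hu using Algebra.adjoin_induction generalizing v with
  | mem u hu =>
    obtain ⟨i, rfl⟩ := hu
    rw [diagramRep_gen]
    exact capCupEnd_mem_supported _ _
      (fun p hp ↦ (p.lineCount_capCup_le i.2.1 i.2.2 m).trans hp) hv
  | algebraMap a =>
    rw [AlgHom.commutes, Module.algebraMap_end_apply]
    exact Submodule.smul_mem _ a hv
  | add u w _ _ hu hw =>
    rw [map_add, LinearMap.add_apply]
    exact add_mem (hu hv) (hw hv)
  | mul u w _ _ hu hw =>
    rw [map_mul, Module.End.mul_apply]
    exact hu (hw hv)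

theorem diagramRep_mem_supported_of_mem_freeIdeal {T : FibonacciSet N} {u : OkadaAlgebra N x y}
    (hu : u ∈ freeIdeal x y T) (v : ArcDiagram →₀ K) (m : ℕ) :
    diagramRep hc hcy u v ∈
      Finsupp.supported K K {p | p.lineCount N m ≤ (T.carrier.filter (m ≤ ·)).card} := by
  induction hu using TwoSidedIdeal.span_induction generalizing v with
  | mem u hu =>
    rw [Set.mem_singleton_iff.1 hu, diagramRep_freeElement]
    refine Finsupp.supported_mono (fun p hp ↦ T.lineCount_le_card_filter hp m)
      (prod_capCupEnd_mem_supported c _ T.pairwise_freeList v)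
  | zero => simp
  | add u w _ _ hu hw =>
    rw [map_add, LinearMap.add_apply]
    exact add_mem (hu v) (hw v)
  | neg u _ hu =>
    rw [map_neg, LinearMap.neg_apply]
    exact neg_mem (hu v)
  | left_absorb w u _ hu =>
    rw [map_mul, Module.End.mul_apply]
    exact diagramRep_mem_supported_lineCount_le hc hcy w m _ (hu v)
  | right_absorb w u _ hu =>
    rw [map_mul, Module.End.mul_apply]
    exact hu (diagramRep hc hcy w v)

theorem dominatedBy_of_freeIdeal_le (hy : ∀ i, 1 ≤ i → i + 2 ≤ N → y i ≠ 0)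
    {S T : FibonacciSet N} (h : freeIdeal x y S ≤ freeIdeal x y T) : S.DominatedBy T := by
  rw [FibonacciSet.dominatedBy_iff_card_filter_le]
  intro m
  obtain ⟨c, hc, hcy⟩ := exists_ne_zero_mul_succ_eq y
  have hcy' (i : ℕ) (hi : 1 ≤ i) (hiN : i + 2 ≤ N) := hcy i (hy i hi hiN)
  obtain ⟨p, a, ha, hpa, hp⟩ :=
    exists_prod_capCupEnd_single_unlinked (fun l ↦ x l / c l) hc S.pairwise_freeList
  have hmem := diagramRep_mem_supported_of_mem_freeIdeal hc hcy'
    (h (TwoSidedIdeal.subset_span rfl)) (Finsupp.single unlinked 1) m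
  rw [diagramRep_freeElement, hpa, Finsupp.mem_supported, Finsupp.support_single _ ha,
    Finset.coe_singleton, Set.singleton_subset_iff] at hmem
  exact (S.card_filter_le_lineCount hp m).trans hmem

end OkadaAlgebra

theorem mainTheorem9 {K : Type*} [Field K] (N : ℕ) (x y : ℕ → K)
    (hy : ∀ i, 1 ≤ i → i + 2 ≤ N → y i ≠ 0) (S T : FibonacciSet N) :
    OkadaAlgebra.freeIdeal x y S ≤ OkadaAlgebra.freeIdeal x y T ↔ S.DominatedBy T :=
  ⟨OkadaAlgebra.dominatedBy_of_freeIdeal_le hy, OkadaAlgebra.freeIdeal_le_of_dominatedBy hy⟩
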